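/- Let $d\ge 2$ and let $T:\mathcal M_d\to\mathcal M_d$ be a quantum channel on $\mathcal M_d=\mathbb C^{d\times d}$ in the Heisenberg picture, that is, $T(f)=\sum_{i=1}^{D}K_i^\dagger fK_i$ with $\sum_iK_i^\dagger K_i=\mathbb 1$. Assume that $T$ is - $D$-regular: the $D$ Kraus operators $K_1,\dots,K_D$ can be chosen linearly independent; - unital: $T^*(\mathbb 1)=\mathbb 1$, where $T^*$ is the dual of $T$ for the Hilbert–Schmidt inner product; - reversible with respect to $\sigma=\mathbb 1/d$: $\Gamma_\sigma\circ T=T^*\circ\Gamma_\sigma$, where $\Gamma_\sigma^{s}(f)=\sigma^{s/2}f\sigma^{s/2}$. Put $\mathcal L=T-\mathrm{id}$ and, for positive definite $f\in\mathcal M_d$, $$\mathcal E_2(f)=-\operatorname{tr}\big[\Gamma_\sigma(f)\,\mathcal L(f)\big],\qquad \|f\|_{2,\sigma}^2=\operatorname{tr}\big[(\Gamma_\sigma^{1/2}(f))^2\big],$$ $$\mathrm{Ent}_2(f)=\operatorname{tr}\big[(\Gamma_\sigma^{1/2}(f))^2\log\Gamma_\sigma^{1/2}(f)\big]-\tfrac12\operatorname{tr}\big[(\Gamma_\sigma^{1/2}(f))^2\log\sigma\big]-\tfrac12\|f\|_{2,\sigma}^2\log\|f\|_{2,\sigma}^2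 ,$$ with natural logarithms. Then there is a largest real number $\alpha_2$ with $\alpha_2\,\mathrm{Ent}_2(f)\le\mathcal E_2(f)$ for all positive definite $f$ (the $LS_2$ constant of $\mathcal L$), and $$\alpha_2\le\log D\;\frac{4+\log\log d}{2\log(3d/4)} .$$ -/

import Mathlib

open scoped ComplexOrder Matrix

namespace QuantumLS

noncomputable section

/-- The algebra `M_d` of complex `d × d` matrices. -/
abbrev Mat (d : ℕ) : Type := Matrix (Fin d) (Fin d) ℂ

/-- Superoperators: linear maps `M_d → M_d`. -/
abbrev SuperOp (d : ℕ) : Type := Mat d →ₗ[ℂ] Mat d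

/-- The real power `σ ^ s` of a Hermitian matrix, by functional calculus
(used for positive definite `σ`). -/
def matPow {d : ℕ} (σ : Mat d) (s : ℝ) : Mat d := cfc (fun x : ℝ => x ^ s) σ

/-- The natural logarithm of a Hermitian matrix, by functional calculus
(used for positive definite matrices). -/
def matLog {d : ℕ} (σ : Mat d) : Mat d := cfc Real.log σ

/-- `Γ_σ ^ s (f) = σ ^ (s / 2) f σ ^ (s / 2)`, as a linear map in `f`. -/
def Γpow {d : ℕ} (σ : Mat d) (s : ℝ) : SuperOp d :=
  LinearMap.mulLeft ℂ (matPow σ (s / 2)) ∘ₗ LinearMap.mulRight ℂ (matPow σ (s / 2))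

/-- The weighted inner product `⟨f, g⟩_σ = tr (Γ_σ(f) g)`, which is real for Hermitian `f`, `g`. -/
def weightedInner {d : ℕ} (σ f g : Mat d) : ℝ := (Γpow σ 1 f * g).trace.re

/-- The squared weighted norm `‖f‖²_{2,σ} = tr |Γ_σ^{1/2}(f)|²`. -/
def weightedNormSq {d : ℕ} (σ f : Mat d) : ℝ :=
  ((Γpow σ (1 / 2) f)ᴴ * Γpow σ (1 / 2) f).trace.re

/-- The `L₂` relative entropy
`Ent₂(f) = tr[(Γ_σ^{1/2} f)² log (Γ_σ^{1/2} f)] - ½ tr[(Γ_σ^{1/2} f)² log σ]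
  - ½ ‖f‖²_{2,σ} log ‖f‖²_{2,σ}` of a positive definite `f`. -/
def ent₂ {d : ℕ} (σ f : Mat d) : ℝ :=
  (Γpow σ (1 / 2) f ^ 2 * matLog (Γpow σ (1 / 2) f)).trace.re
    - 1 / 2 * (Γpow σ (1 / 2) f ^ 2 * matLog σ).trace.re
    - 1 / 2 * weightedNormSq σ f * Real.log (weightedNormSq σ f)

/-- The `L₂` Dirichlet form `E₂(f) = -⟨f, L(f)⟩_σ`. -/
def dirichlet₂ {d : ℕ} (σ : Mat d) (L : SuperOp d) (f : Mat d) : ℝ :=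
  -weightedInner σ f (L f)

/-- `α` is the `LS₂` constant of `L` with respect to `σ`: the largest real number with
`α Ent₂(f) ≤ E₂(f)` for all positive definite `f`. -/
def IsLSConstant₂ {d : ℕ} (σ : Mat d) (L : SuperOp d) (α : ℝ) : Prop :=
  IsGreatest {a : ℝ | ∀ f : Mat d, f.PosDef → a * ent₂ σ f ≤ dirichlet₂ σ L f} α

/-- The dual `T*` of `T` for the Hilbert–Schmidt inner product `(X, Y) ↦ tr (Xᴴ Y)`;
see `trace_hsDual`. -/
def hsDual {d : ℕ} (T : SuperOp d) : SuperOp d where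
  toFun Y := Matrix.of fun i j => ((T (Matrix.single i j 1))ᴴ * Y).trace
  map_add' X Y := by
    ext i j
    simp [Matrix.mul_add]
  map_smul' c X := by
    ext i j
    simp

/-- The defining property of the Hilbert–Schmidt dual. -/
theorem trace_hsDual {d : ℕ} (T : SuperOp d) (X Y : Mat d) :
    (Xᴴ * hsDual T Y).trace = ((T X)ᴴ * Y).trace := by
  have key : T X = ∑ i, ∑ j, X i j • T (Matrix.single i j 1) := by
    conv_lhs => rw [Matrix.matrix_eq_sum_single X]
    simp only [map_sum]
    refine Finset.sum_congr rfl fun i _ => Finset.sum_congr rfl fun j _ => ?_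
    rw [← map_smul, Matrix.smul_single, smul_eq_mul, mul_one]
  rw [key]
  simp only [Matrix.conjTranspose_sum, Matrix.conjTranspose_smul, Matrix.sum_mul,
    Matrix.trace_sum, Matrix.smul_mul, Matrix.trace_smul, smul_eq_mul]
  rw [Finset.sum_comm]
  simp only [Matrix.trace, Matrix.diag_apply, Matrix.mul_apply, Matrix.conjTranspose_apply,
    hsDual, LinearMap.coe_mk, AddHom.coe_mk, Matrix.of_apply]

/-- Detailed balance of a superoperator with respect to `σ`: `Γ_σ ∘ T = T* ∘ Γ_σ`. -/
def IsReversible {d : ℕ} (σ : Mat d) (T : SuperOp d) : Prop :=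
  Γpow σ 1 ∘ₗ T = hsDual T ∘ₗ Γpow σ 1

/-- `T`, acting on observables (Heisenberg picture), is a `D`-regular quantum channel: it has a
Kraus representation `T(f) = ∑ᵢ Kᵢᴴ f Kᵢ` with exactly `D` linearly independent operators, where
`∑ᵢ Kᵢᴴ Kᵢ = 1` expresses that the evolution of states is trace preserving. -/
def IsRegularChannel {d : ℕ} (D : ℕ) (T : SuperOp d) : Prop :=
  ∃ K : Fin D → Mat d, LinearIndependent ℂ K ∧ ∑ i, (K i)ᴴ * K i = 1 ∧
    ∀ f : Mat d, T f = ∑ i, (K i)ᴴ * f * K i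

/-- Unitality: the evolution of states fixes the identity, `T*(1) = 1`. -/
def IsUnital {d : ℕ} (T : SuperOp d) : Prop := hsDual T 1 = 1

/-- The maximally mixed state `1 / d`. -/
def maxMixed (d : ℕ) : Mat d := (d : ℂ)⁻¹ • (1 : Mat d)

end

end QuantumLS

namespace QuantumLS

open Matrix Filter Topology

/-! The upper bound comes from testing the inequality on pure states. Taking `P + ε • (1 - P)` with
`P` the projection onto a unit vector `ψ` and letting `ε → 0` turns any admissible `a` into `a *
(log d / 2) ≤ 1 - ∑ i, |⟨ψ, K i ψ⟩|²` (`bound_of_unit_vector`). It remains to choose `ψ`. For `D =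
1` the Kraus operator is unitary and an eigenvector makes the right side `0`. For `D = 2` some `ψ`
makes it at most `3/4` (`exists_unit_sum_normSq_ge`). For `D ≥ 3` the trivial bound `1` suffices,
since `log D ≥ 1`. In each case the right side is at most `(5/4) log D`, which
`le_mul_div_log_of_le` converts into the stated bound. The maximum exists because the admissible set
is closed, bounded above by this estimate, and contains `0` (`dirichlet₂_nonneg`). -/

/-! ### Functional calculus and entropy at the maximally mixed state. -/

/-- The functional calculus of a matrix with two spectral values `a`, `b`. -/
theorem cfc_smul_proj_add {d : ℕ} {P : Mat d} (hP : P.IsHermitian) (hPP : P * P = P)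
    (a b : ℝ) (g : ℝ → ℝ) :
    cfc g (a • P + b • (1 - P)) = g a • P + g b • (1 - P) := by
  set M : Mat d := a • P + b • (1 - P) with hM
  have hsa : IsSelfAdjoint M := by
    have h1 : IsSelfAdjoint P := hP
    exact ((IsSelfAdjoint.all a).smul h1).add
      ((IsSelfAdjoint.all b).smul ((IsSelfAdjoint.one _).sub h1))
  by_cases hab : a = b
  · subst hab
    have h1 : M = algebraMap ℝ (Mat d) a := by
      rw [hM, Algebra.algebraMap_eq_smul_one, ← smul_add, add_sub_cancel]
    rw [h1, cfc_algebraMap, Algebra.algebraMap_eq_smul_one, ← smul_add, add_sub_cancel]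
  have hba : a - b ≠ 0 := sub_ne_zero.2 hab
  have hspec : ∀ x ∈ spectrum ℝ M, x = a ∨ x = b := by
    intro x hx
    by_contra! hne
    refine hx ?_
    have ha : x - a ≠ 0 := sub_ne_zero.2 hne.1
    have hb : x - b ≠ 0 := sub_ne_zero.2 hne.2
    have e : algebraMap ℝ (Mat d) x - M = (x - a) • P + (x - b) • (1 - P) := by
      rw [hM, Algebra.algebraMap_eq_smul_one]
      module
    have hPQ : P * (1 - P) = 0 := by rw [mul_sub, hPP, mul_one, sub_self]
    have hQP : (1 - P) * P = 0 := by rw [sub_mul, hPP, one_mul, sub_self]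
    have hQQ : (1 - P) * (1 - P) = 1 - P := by rw [mul_sub, hQP, mul_one, sub_zero]
    have hinv : ∀ s t u v : ℝ, s * u = 1 → t * v = 1 →
        (s • P + t • (1 - P)) * (u • P + v • (1 - P)) = 1 := by
      intro s t u v h1 h2
      simp only [mul_add, add_mul, smul_mul_smul_comm, hPP, hPQ, hQP, hQQ, h1, h2, smul_zero,
        one_smul, zero_add, add_zero, add_sub_cancel]
    rw [spectrum.mem_resolventSet_iff, e]
    exact ⟨⟨_, (x - a)⁻¹ • P + (x - b)⁻¹ • (1 - P),
      hinv _ _ _ _ (mul_inv_cancel₀ ha) (mul_inv_cancel₀ hb),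
      hinv _ _ _ _ (inv_mul_cancel₀ ha) (inv_mul_cancel₀ hb)⟩, rfl⟩
  -- On a spectrum inside `{a, b}`, `g` agrees with its affine interpolant, whose calculus is
  -- explicit.
  have hcongr : cfc g M =
      cfc (fun x => (g a - g b) / (a - b) * x + (g b - (g a - g b) / (a - b) * b)) M := by
    refine cfc_congr fun x hx => ?_
    rcases hspec x hx with rfl | rfl
    · field_simp; ring
    · ring
  rw [hcongr, cfc_add_const _ _ _, cfc_const_mul_id _ _, hM, Algebra.algebraMap_eq_smul_one]
  have e2 : (g a - g b) / (a - b) * (a - b) = g a - g b := div_mul_cancel₀ _ hba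
  have e3 : (g a - g b) / (a - b) * a = g a - g b + (g a - g b) / (a - b) * b := by linarith
  simp only [smul_add, smul_smul, e3]
  module

theorem maxMixed_eq {d : ℕ} : maxMixed d = algebraMap ℝ (Mat d) ((d : ℝ)⁻¹) := by
  rw [maxMixed, Algebra.algebraMap_eq_smul_one]
  ext i j
  simp [Matrix.smul_apply]

theorem Γpow_maxMixed {d : ℕ} (hd : 0 < d) (s : ℝ) (f : Mat d) :
    Γpow (maxMixed d) s f = ((d : ℝ)⁻¹ ^ s) • f := by
  have h : matPow (maxMixed d) (s / 2) = algebraMap ℝ (Mat d) ((d : ℝ)⁻¹ ^ (s / 2)) := by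
    rw [matPow, maxMixed_eq, cfc_algebraMap]
  have hd' : (0 : ℝ) < (d : ℝ)⁻¹ := by positivity
  simp only [Γpow, h, LinearMap.comp_apply, LinearMap.mulLeft_apply, LinearMap.mulRight_apply,
    Algebra.algebraMap_eq_smul_one, mul_smul_comm, smul_mul_assoc, one_mul, mul_one, smul_smul]
  rw [← Real.rpow_add hd', add_halves]

theorem dirichlet₂_maxMixed {d : ℕ} (hd : 0 < d) (T : SuperOp d) (f : Mat d) :
    dirichlet₂ (maxMixed d) (T - LinearMap.id) f
      = (d : ℝ)⁻¹ * ((f * f).trace.re - (f * T f).trace.re) := by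
  simp [dirichlet₂, weightedInner, Γpow_maxMixed hd, mul_sub]

theorem ent₂_maxMixed {d : ℕ} (hd : 0 < d) {P : Mat d} (hP : P.IsHermitian) (hPP : P * P = P)
    (htr : P.trace = 1) {ε : ℝ} :
    ent₂ (maxMixed d) (P + ε • (1 - P)) =
      (d : ℝ)⁻¹ * (Real.log ((d : ℝ)⁻¹ ^ (1 / 2 : ℝ))
        + (d - 1) * ε ^ 2 * Real.log ((d : ℝ)⁻¹ ^ (1 / 2 : ℝ) * ε))
      + 1 / 2 * ((d : ℝ)⁻¹ * (1 + (d - 1) * ε ^ 2)) * Real.log d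
      - 1 / 2 * ((d : ℝ)⁻¹ * (1 + (d - 1) * ε ^ 2))
        * Real.log ((d : ℝ)⁻¹ * (1 + (d - 1) * ε ^ 2)) := by
  set c : ℝ := (d : ℝ)⁻¹ ^ (1 / 2 : ℝ) with hc
  have hcc : c * c = (d : ℝ)⁻¹ := by
    rw [hc, ← Real.sqrt_eq_rpow]; exact Real.mul_self_sqrt (by positivity)
  have hX : Γpow (maxMixed d) (1 / 2) (P + ε • (1 - P)) = c • P + (c * ε) • (1 - P) := by
    rw [Γpow_maxMixed hd, smul_add, smul_smul]
  have hlog : matLog (c • P + (c * ε) • (1 - P))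
      = Real.log c • P + Real.log (c * ε) • (1 - P) := cfc_smul_proj_add hP hPP _ _ _
  have hσ : matLog (maxMixed d) = (-Real.log d) • (1 : Mat d) := by
    rw [matLog, maxMixed_eq, cfc_algebraMap, Real.log_inv, Algebra.algebraMap_eq_smul_one]
  have hPQ : P * (1 - P) = 0 := by rw [mul_sub, hPP, mul_one, sub_self]
  have hQP : (1 - P) * P = 0 := by rw [sub_mul, hPP, one_mul, sub_self]
  have hQQ : (1 - P) * (1 - P) = 1 - P := by rw [mul_sub, hQP, mul_one, sub_zero]
  have hmul : ∀ s t u v : ℝ, (s • P + t • (1 - P)) * (u • P + v • (1 - P))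
      = (s * u) • P + (t * v) • (1 - P) := by
    intro s t u v
    simp only [mul_add, add_mul, smul_mul_smul_comm, hPP, hPQ, hQP, hQQ, smul_zero, zero_add,
      add_zero]
  have htrace : ∀ s t : ℝ, (s • P + t • (1 - P)).trace.re = s + t * (d - 1) := by
    intro s t
    simp [htr, trace_add, trace_smul, trace_sub, trace_one]
  have hherm : (c • P + (c * ε) • (1 - P))ᴴ = c • P + (c * ε) • (1 - P) := by
    simp [conjTranspose_smul, hP.eq]
  have hN : weightedNormSq (maxMixed d) (P + ε • (1 - P)) = (d : ℝ)⁻¹ * (1 + (d - 1) * ε ^ 2) := by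
    rw [weightedNormSq, hX, hherm, hmul, htrace, ← hcc]
    ring
  rw [ent₂, hN, hX, hlog, hσ, sq (c • P + (c * ε) • (1 - P)), hmul, hmul, htrace, mul_smul_comm,
    mul_one, trace_smul, Complex.smul_re, htrace, ← hcc, smul_eq_mul]
  ring

/-! ### Rank-one test functions and the Dirichlet form. -/

/-- `P` itself need not be positive definite, so it is approached by `P + ε • (1 - P)`. In the limit
the entropy is `log d / (2d)` and the Dirichlet form is `(1 - tr (P T(P))) / d`. -/
theorem le_of_forall_mul_ent₂_le {d : ℕ} (hd : 0 < d) (T : SuperOp d) {a : ℝ}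
    (ha : ∀ f : Mat d, f.PosDef → a * ent₂ (maxMixed d) f ≤
      dirichlet₂ (maxMixed d) (T - LinearMap.id) f)
    {P : Mat d} (hP : P.IsHermitian) (hPP : P * P = P) (htr : P.trace = 1) :
    a * (Real.log d / 2) ≤ 1 - (P * T P).trace.re := by
  have hd0 : (0 : ℝ) < d := by exact_mod_cast hd
  have hQQ : (1 - P) * (1 - P) = 1 - P := by
    rw [mul_sub, mul_one, sub_mul, hPP, one_mul, sub_self, sub_zero]
  have hQ : (1 - P).IsHermitian := isHermitian_one.sub hP
  have hPs : P.PosSemidef := by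
    have := posSemidef_conjTranspose_mul_self P
    rwa [hP.eq, hPP] at this
  have hQs : (1 - P).PosSemidef := by
    have := posSemidef_conjTranspose_mul_self (1 - P)
    rwa [hQ.eq, hQQ] at this
  have hpd : ∀ ε : ℝ, 0 < ε → ε < 1 → (P + ε • (1 - P)).PosDef := by
    intro ε h0 h1
    have e : P + ε • (1 - P) = ε • (1 : Mat d) + (1 - ε) • P := by module
    rw [e]
    exact (PosDef.one.smul h0).add_posSemidef (hPs.smul (by linarith))
  have hE : Continuous fun ε : ℝ =>
      dirichlet₂ (maxMixed d) (T - LinearMap.id) (P + ε • (1 - P)) := by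
    have e : ∀ ε : ℝ, T (P + ε • (1 - P)) = T P + ε • T (1 - P) := by
      intro ε
      rw [map_add, LinearMap.map_smul_of_tower]
    simp only [dirichlet₂_maxMixed hd, e]
    fun_prop
  have hN : Continuous fun ε : ℝ =>
      (d : ℝ)⁻¹ * (Real.log ((d : ℝ)⁻¹ ^ (1 / 2 : ℝ))
        + (d - 1) * ε ^ 2 * Real.log ((d : ℝ)⁻¹ ^ (1 / 2 : ℝ) * ε))
      + 1 / 2 * ((d : ℝ)⁻¹ * (1 + (d - 1) * ε ^ 2)) * Real.log d
      - 1 / 2 * ((d : ℝ)⁻¹ * (1 + (d - 1) * ε ^ 2))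
        * Real.log ((d : ℝ)⁻¹ * (1 + (d - 1) * ε ^ 2)) := by
    have hd1 : (1 : ℝ) ≤ d := by exact_mod_cast hd
    set c : ℝ := (d : ℝ)⁻¹ ^ (1 / 2 : ℝ) with hc
    have hc0 : c ≠ 0 := by positivity
    have h1 : Continuous fun ε : ℝ => (d - 1) * ε ^ 2 * Real.log (c * ε) := by
      -- One factor `ε` is traded for `c * ε`, so that continuity of `x log x` handles `ε = 0`.
      have : (fun ε : ℝ => (d - 1) * ε ^ 2 * Real.log (c * ε))
          = fun ε : ℝ => (d - 1) * (ε / c) * ((c * ε) * Real.log (c * ε)) := by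
        ext ε; field_simp
      rw [this]
      have h2 := Real.continuous_mul_log.comp
        (continuous_const.mul continuous_id : Continuous fun ε : ℝ => c * ε)
      exact Continuous.mul (by fun_prop) h2
    have h3 : Continuous fun ε : ℝ => Real.log ((d : ℝ)⁻¹ * (1 + (d - 1) * ε ^ 2)) := by
      refine Continuous.log (by fun_prop) fun ε => ?_
      have : 0 ≤ ((d : ℝ) - 1) * ε ^ 2 := mul_nonneg (by linarith) (sq_nonneg _)
      positivity
    fun_prop
  have hlim := le_of_tendsto_of_tendsto
    (((hN.tendsto 0).mono_left nhdsWithin_le_nhds).const_mul a)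
    ((hE.tendsto 0).mono_left (nhdsWithin_le_nhds (s := Set.Ioi 0))) (by
      filter_upwards [Ioo_mem_nhdsGT (zero_lt_one' ℝ)] with ε hε
      rw [← ent₂_maxMixed hd hP hPP htr]
      exact ha _ (hpd ε hε.1 hε.2))
  rw [dirichlet₂_maxMixed hd] at hlim
  simp only [zero_smul, add_zero, hPP, htr, Complex.one_re, ne_eq, OfNat.ofNat_ne_zero,
    not_false_eq_true, zero_pow, mul_zero, zero_mul, mul_one, Real.log_inv,
    Real.log_rpow (inv_pos.2 hd0)] at hlim
  have h4 : (d : ℝ)⁻¹ * (a * (Real.log d / 2)) ≤ (d : ℝ)⁻¹ * (1 - (P * T P).trace.re) := by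
    linarith
  exact le_of_mul_le_mul_left h4 (by positivity)

/-- Up to the factor `1 / (2d)` the form is `∑ i, tr |[K i, f]|²`. Both square terms equal `tr f²`:
one by `∑ (K i)ᴴ K i = 1`, the other by unitality. -/
theorem dirichlet₂_nonneg {d D : ℕ} (hd : 0 < d) {T : SuperOp d} (K : Fin D → Mat d)
    (hK : ∑ i, (K i)ᴴ * K i = 1) (hT : ∀ f : Mat d, T f = ∑ i, (K i)ᴴ * f * K i)
    (hunital : IsUnital T) {f : Mat d} (hf : f.IsHermitian) :
    0 ≤ dirichlet₂ (maxMixed d) (T - LinearMap.id) f := by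
  rw [dirichlet₂_maxMixed hd]
  refine mul_nonneg (by positivity) ?_
  have hsq : ∀ X : Mat d, 0 ≤ (Xᴴ * X).trace.re := fun X =>
    (Complex.le_def.1 (posSemidef_conjTranspose_mul_self X).trace_nonneg).1
  have h1 : (∑ i, (K i * f)ᴴ * (K i * f)).trace = (f * f).trace := by
    have : ∀ i, (K i * f)ᴴ * (K i * f) = f * ((K i)ᴴ * K i) * f := by
      intro i; rw [conjTranspose_mul, hf.eq]; simp only [mul_assoc]
    simp only [this, ← Finset.sum_mul, ← Finset.mul_sum, hK, mul_one]
  have h2 : (∑ i, (f * K i)ᴴ * (f * K i)).trace = (f * f).trace := by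
    have e : ∑ i, (f * K i)ᴴ * (f * K i) = T (f * f) := by
      rw [hT]
      refine Finset.sum_congr rfl fun i _ => ?_
      rw [conjTranspose_mul, hf.eq]; simp only [mul_assoc]
    have e2 : (T (f * f))ᴴ = T (f * f) := by
      rw [← e]; simp [conjTranspose_sum, conjTranspose_mul]
    have := trace_hsDual T (f * f) 1
    rw [hunital, e2, mul_one, mul_one, conjTranspose_mul, hf.eq] at this
    rw [e, ← this]
  have h3 : (f * T f).trace = (∑ i, (K i * f)ᴴ * (f * K i)).trace := by
    rw [hT, Finset.mul_sum]
    congr 1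
    refine Finset.sum_congr rfl fun i _ => ?_
    rw [conjTranspose_mul, hf.eq]; simp only [mul_assoc]
  have h4 : (f * T f).trace.re = (∑ i, (f * K i)ᴴ * (K i * f)).trace.re := by
    have : (∑ i, (f * K i)ᴴ * (K i * f)) = (∑ i, (K i * f)ᴴ * (f * K i))ᴴ := by
      simp [conjTranspose_sum, conjTranspose_mul]
    rw [this, trace_conjTranspose, h3]; simp
  have h5 : 0 ≤ (∑ i, (K i * f - f * K i)ᴴ * (K i * f - f * K i)).trace.re := by
    rw [trace_sum, Complex.re_sum]
    exact Finset.sum_nonneg fun i _ => hsq _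
  simp only [conjTranspose_sub, sub_mul, mul_sub, Finset.sum_sub_distrib, trace_sub,
    Complex.sub_re, h1, h2, ← h3, ← h4] at h5
  linarith

theorem trace_proj_mul_channel {d D : ℕ} {T : SuperOp d} (K : Fin D → Mat d)
    (hT : ∀ f : Mat d, T f = ∑ i, (K i)ᴴ * f * K i) (ψ : Fin d → ℂ) :
    (vecMulVec ψ (star ψ) * T (vecMulVec ψ (star ψ))).trace.re
      = ∑ i, Complex.normSq (star ψ ⬝ᵥ K i *ᵥ ψ) := by
  rw [hT, Finset.mul_sum, trace_sum, Complex.re_sum]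
  refine Finset.sum_congr rfl fun i _ => ?_
  have h : star ψ ⬝ᵥ (K i)ᴴ *ᵥ ψ = star (star ψ ⬝ᵥ K i *ᵥ ψ) := by
    rw [← star_dotProduct_star, star_star, star_mulVec, dotProduct_mulVec, dotProduct_comm]
  rw [mul_vecMulVec, vecMulVec_mul _ _ (K i), vecMulVec_mul_vecMulVec, trace_vecMulVec,
    dotProduct_smul, h, dotProduct_comm ψ, ← dotProduct_mulVec]
  simp [Complex.normSq_apply]

theorem bound_of_unit_vector {d D : ℕ} (hd : 0 < d) {T : SuperOp d} (K : Fin D → Mat d)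
    (hT : ∀ f : Mat d, T f = ∑ i, (K i)ᴴ * f * K i) {a : ℝ}
    (ha : ∀ f : Mat d, f.PosDef → a * ent₂ (maxMixed d) f ≤
      dirichlet₂ (maxMixed d) (T - LinearMap.id) f)
    {ψ : Fin d → ℂ} (hψ : star ψ ⬝ᵥ ψ = 1) :
    a * (Real.log d / 2) ≤ 1 - ∑ i, Complex.normSq (star ψ ⬝ᵥ K i *ᵥ ψ) := by
  rw [← trace_proj_mul_channel K hT ψ]
  refine le_of_forall_mul_ent₂_le hd T ha ?_ ?_ ?_
  · rw [IsHermitian, conjTranspose_vecMulVec, star_star]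
  · rw [vecMulVec_mul_vecMulVec, hψ, one_smul]
  · rw [trace_vecMulVec, dotProduct_comm, hψ]

/-! ### Unit vectors with large Kraus expectation values. -/

/-- Some eigenvector of a Hermitian matrix has a squared eigenvalue at least the average. -/
theorem exists_unit_sq_quadForm_ge {d : ℕ} (hd : 0 < d) {H : Mat d} (hH : H.IsHermitian) :
    ∃ ψ : Fin d → ℂ, star ψ ⬝ᵥ ψ = 1 ∧
      (H * H).trace.re / d ≤ (star ψ ⬝ᵥ H *ᵥ ψ).re ^ 2 := by
  have : Nonempty (Fin d) := ⟨⟨0, hd⟩⟩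
  have htr : (H * H).trace.re = ∑ i, hH.eigenvalues i ^ 2 := by
    have h := hH.spectral_theorem
    set U := hH.eigenvectorUnitary
    have e : H * H = (U : Mat d) * (diagonal (RCLike.ofReal ∘ hH.eigenvalues)
        * diagonal (RCLike.ofReal ∘ hH.eigenvalues)) * star (U : Mat d) := by
      conv_lhs => rw [h]
      rw [Unitary.conjStarAlgAut_apply]
      have hU : star (U : Mat d) * (U : Mat d) = 1 := Unitary.coe_star_mul_self U
      simp only [mul_assoc]
      rw [← mul_assoc (star (U : Mat d)) (U : Mat d), hU, one_mul]
    have hU : star (U : Mat d) * (U : Mat d) = 1 := Unitary.coe_star_mul_self U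
    rw [e, trace_mul_comm, ← mul_assoc, hU, one_mul, diagonal_mul_diagonal, trace_diagonal,
      Complex.re_sum]
    simp [sq]
  obtain ⟨k, -, hk⟩ := Finset.exists_max_image Finset.univ (fun i => hH.eigenvalues i ^ 2)
    Finset.univ_nonempty
  have hψ : star (hH.eigenvectorBasis k).ofLp ⬝ᵥ (hH.eigenvectorBasis k).ofLp = 1 := by
    have h := hH.eigenvectorBasis.orthonormal.1 k
    have h2 : inner ℂ (hH.eigenvectorBasis k) (hH.eigenvectorBasis k) = (1 : ℂ) := by
      rw [inner_self_eq_norm_sq_to_K, h]; simp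
    rwa [EuclideanSpace.inner_eq_star_dotProduct, dotProduct_comm] at h2
  refine ⟨(hH.eigenvectorBasis k).ofLp, hψ, ?_⟩
  have hev := hH.mulVec_eigenvectorBasis k
  rw [hev, dotProduct_smul, hψ, htr, div_le_iff₀ (by exact_mod_cast hd)]
  have := Finset.sum_le_card_nsmul Finset.univ (fun i => hH.eigenvalues i ^ 2) _
    fun i hi => hk i hi
  simp at this ⊢
  linarith

/-- Kraus operators cannot all have small numerical radius. -/
theorem exists_unit_sum_normSq_ge {d D : ℕ} (hd : 0 < d) (hD : 0 < D) (K : Fin D → Mat d)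
    (hK : ∑ i, (K i)ᴴ * K i = 1) :
    ∃ ψ : Fin d → ℂ, star ψ ⬝ᵥ ψ = 1 ∧
      1 / (2 * D : ℝ) ≤ ∑ i, Complex.normSq (star ψ ⬝ᵥ K i *ᵥ ψ) := by
  have : Nonempty (Fin D) := ⟨⟨0, hD⟩⟩
  have hd0 : (0 : ℝ) < d := by exact_mod_cast hd
  have hD0 : (0 : ℝ) < D := by exact_mod_cast hD
  have hsum : ∑ i, ((K i)ᴴ * K i).trace.re = d := by
    rw [← Complex.re_sum, ← trace_sum, hK, trace_one]; simp
  obtain ⟨i, -, hi⟩ : ∃ i ∈ Finset.univ, (d : ℝ) / D ≤ ((K i)ᴴ * K i).trace.re := by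
    refine Finset.exists_le_of_sum_le Finset.univ_nonempty ?_
    rw [hsum]
    simp
    field_simp
    exact le_rfl
  have hquad : ∀ ψ : Fin d → ℂ, star ψ ⬝ᵥ (K i)ᴴ *ᵥ ψ = star (star ψ ⬝ᵥ K i *ᵥ ψ) := fun ψ => by
    rw [← star_dotProduct_star, star_star, star_mulVec, dotProduct_mulVec, dotProduct_comm]
  -- Cartesian decomposition `K i = A - I • B`, where `K i` has at least the average squared
  -- Hilbert–Schmidt norm `d / D`. The larger of `tr A²`, `tr B²` is at least half of that, whence
  -- the `2` in `2 * D`.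
  set A : Mat d := (1 / 2 : ℂ) • (K i + (K i)ᴴ) with hA
  set B : Mat d := (Complex.I / 2) • (K i - (K i)ᴴ) with hB
  have hAh : A.IsHermitian := by
    rw [IsHermitian, hA, conjTranspose_smul, conjTranspose_add, conjTranspose_conjTranspose,
      add_comm]
    simp
  have hBh : B.IsHermitian := by
    rw [IsHermitian, hB, conjTranspose_smul, conjTranspose_sub, conjTranspose_conjTranspose,
      ← neg_sub, smul_neg, ← neg_smul]
    congr 1
    simp [neg_div]
  have htr : (A * A).trace + (B * B).trace = ((K i)ᴴ * K i).trace := by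
    rw [hA, hB]
    simp only [smul_mul_smul_comm, trace_smul, mul_add, add_mul, mul_sub, sub_mul, trace_add,
      trace_sub, trace_mul_comm (K i) (K i)ᴴ, smul_eq_mul]
    linear_combination (1 / 4 * ((K i * K i).trace - ((K i)ᴴ * K i).trace
      - (((K i)ᴴ * K i).trace - ((K i)ᴴ * (K i)ᴴ).trace))) * Complex.I_sq
  have htr' := congrArg Complex.re htr
  rw [Complex.add_re] at htr'
  have hone : ∀ ψ : Fin d → ℂ, ∀ x : ℝ, x ^ 2 ≤ Complex.normSq (star ψ ⬝ᵥ K i *ᵥ ψ) →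
      (d : ℝ) / D / 2 / d ≤ x ^ 2 →
      1 / (2 * D : ℝ) ≤ ∑ i, Complex.normSq (star ψ ⬝ᵥ K i *ᵥ ψ) := by
    intro ψ x h1 h2
    have h3 := Finset.single_le_sum (f := fun j => Complex.normSq (star ψ ⬝ᵥ K j *ᵥ ψ))
      (fun j _ => Complex.normSq_nonneg _) (Finset.mem_univ i)
    have h4 : (d : ℝ) / D / 2 / d = 1 / (2 * D) := by field_simp
    linarith
  rcases le_total ((B * B).trace.re) ((A * A).trace.re) with hle | hle
  · obtain ⟨ψ, hψ, h⟩ := exists_unit_sq_quadForm_ge hd hAh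
    refine ⟨ψ, hψ, hone ψ _ ?_ (le_trans ?_ h)⟩
    · rw [hA, smul_mulVec, add_mulVec, dotProduct_smul, dotProduct_add, hquad,
        Complex.normSq_apply]
      simp
      nlinarith [sq_nonneg (star ψ ⬝ᵥ K i *ᵥ ψ).im]
    · gcongr; linarith
  · obtain ⟨ψ, hψ, h⟩ := exists_unit_sq_quadForm_ge hd hBh
    refine ⟨ψ, hψ, hone ψ _ ?_ (le_trans ?_ h)⟩
    · rw [hB, smul_mulVec, sub_mulVec, dotProduct_smul, dotProduct_sub, hquad,
        Complex.normSq_apply]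
      simp
      nlinarith [sq_nonneg (star ψ ⬝ᵥ K i *ᵥ ψ).re]
    · gcongr; linarith

/-- Eigenvalues of a unitary have modulus one, so any normalised eigenvector works. -/
theorem exists_unit_normSq_eq_one {d : ℕ} (hd : 0 < d) {U : Mat d} (hU : Uᴴ * U = 1) :
    ∃ ψ : Fin d → ℂ, star ψ ⬝ᵥ ψ = 1 ∧ Complex.normSq (star ψ ⬝ᵥ U *ᵥ ψ) = 1 := by
  have : Nonempty (Fin d) := ⟨⟨0, hd⟩⟩
  obtain ⟨μ, hμ⟩ := Module.End.exists_eigenvalue (Matrix.toLin' U)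
  obtain ⟨v, hv⟩ := hμ.exists_hasEigenvector
  have hUv : U *ᵥ v = μ • v := by simpa using hv.apply_eq_smul
  have hv0 : star v ⬝ᵥ v ≠ 0 := fun h =>
    hv.2 (dotProduct_star_self_eq_zero.1 h)
  have hpos : (0 : ℂ) ≤ star v ⬝ᵥ v := dotProduct_star_self_nonneg v
  obtain ⟨hre, him⟩ := Complex.le_def.1 hpos
  set r : ℝ := (star v ⬝ᵥ v).re with hr
  have hvr : star v ⬝ᵥ v = (r : ℂ) := Complex.ext (by simp [hr]) (by simpa using him.symm)
  have hr0 : r ≠ 0 := fun h => hv0 (by rw [hvr, h]; simp)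
  have hrpos : 0 < r := lt_of_le_of_ne (by simpa using hre) hr0.symm
  have hμ1 : Complex.normSq μ = 1 := by
    have h1 : star (U *ᵥ v) ⬝ᵥ (U *ᵥ v) = star v ⬝ᵥ v := by
      rw [star_mulVec, ← dotProduct_mulVec, mulVec_mulVec, hU, one_mulVec]
    rw [hUv, star_smul, smul_dotProduct, dotProduct_smul, smul_eq_mul, smul_eq_mul,
      ← mul_assoc] at h1
    have h2 : star μ * μ = 1 := mul_right_cancel₀ hv0 (by rw [h1, one_mul])
    have h3 := Complex.normSq_eq_conj_mul_self (z := μ)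
    rw [← starRingEnd_apply] at h2
    rw [h2] at h3
    exact_mod_cast h3
  set c : ℂ := Complex.ofReal (Real.sqrt r)⁻¹ with hc
  have hψ : star (c • v) ⬝ᵥ (c • v) = 1 := by
    rw [star_smul, smul_dotProduct, dotProduct_smul, hvr, hc]
    simp only [smul_eq_mul, Complex.star_def, Complex.conj_ofReal]
    norm_cast
    have := Real.mul_self_sqrt hrpos.le
    have h0 : Real.sqrt r ≠ 0 := (Real.sqrt_pos.2 hrpos).ne'
    field_simp
    linarith
  refine ⟨c • v, hψ, ?_⟩
  rw [mulVec_smul, hUv, smul_comm, dotProduct_smul, hψ, smul_eq_mul, mul_one, hμ1]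

/-! ### The scalar estimate and the conclusion. -/

theorem log_three_fourths_mul_pos {d : ℕ} (hd : 2 ≤ d) : 0 < Real.log (3 * d / 4) := by
  have : (2 : ℝ) ≤ d := by exact_mod_cast hd
  exact Real.log_pos (by linarith)

/-- With `x = log d`, the tangent bounds `log (3/4) ≤ -1/4` and `log x ≥ 1 - 1/x` reduce the claim
to `s (4x - 1) ≤ l (5x - 1)`, which follows from `4s ≤ 5l` and `x ≥ 1/2`. -/
theorem le_mul_div_log_of_le {d : ℕ} (hd : 2 ≤ d) {a s l : ℝ} (ha : a * (Real.log d / 2) ≤ s)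
    (hs : 0 ≤ s) (hl : 4 * s ≤ 5 * l) :
    a ≤ l * ((4 + Real.log (Real.log d)) / (2 * Real.log (3 * d / 4))) := by
  have hd2 : (2 : ℝ) ≤ d := by exact_mod_cast hd
  have hx : 0 < Real.log d := Real.log_pos (by linarith)
  have hy := log_three_fourths_mul_pos hd
  have hyx : Real.log (3 * d / 4) ≤ Real.log d - 1 / 4 := by
    have h1 : Real.log (3 * d / 4) = Real.log (3 / 4) + Real.log d := by
      rw [← Real.log_mul (by norm_num) (by linarith)]; ring_nf
    have h2 := Real.log_le_sub_one_of_pos (show (0 : ℝ) < 3 / 4 by norm_num)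
    linarith
  have hll : 1 - (Real.log d)⁻¹ ≤ Real.log (Real.log d) := Real.one_sub_inv_le_log_of_pos hx
  have hx2 : 1 / 2 ≤ Real.log d := by
    have h1 := Real.log_le_log (by norm_num) hd2
    have h2 := Real.log_two_gt_d9
    linarith
  have hl0 : 0 ≤ l := by linarith
  set x := Real.log d
  set y := Real.log (3 * d / 4)
  have h1 : a ≤ 2 * s / x := by
    rw [le_div_iff₀ hx]; linarith
  refine h1.trans ?_
  have h2 : l * ((4 + (1 - x⁻¹)) / (2 * y)) ≤ l * ((4 + Real.log x) / (2 * y)) := by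
    gcongr
  refine le_trans ?_ h2
  have h3 : l * ((4 + (1 - x⁻¹)) / (2 * y)) = l * (5 * x - 1) / (2 * x * y) := by
    field_simp
    ring
  rw [h3, div_le_div_iff₀ hx (by positivity)]
  have h4 : 2 * s * (2 * y) ≤ l * (5 * x - 1) := by
    have h5 : s * y ≤ s * (x - 1 / 4) := mul_le_mul_of_nonneg_left hyx hs
    have h6 : (5 * l - 4 * s) * (1 / 2) ≤ (5 * l - 4 * s) * x :=
      mul_le_mul_of_nonneg_left hx2 (by linarith)
    linarith
  calc 2 * s * (2 * x * y) = 2 * s * (2 * y) * x := by ring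
    _ ≤ l * (5 * x - 1) * x := mul_le_mul_of_nonneg_right h4 hx.le

end QuantumLS

theorem theorem5p3 (d D : ℕ) (hd : 2 ≤ d) (T : QuantumLS.SuperOp d)
    (hreg : QuantumLS.IsRegularChannel D T)
    (hrev : QuantumLS.IsReversible (QuantumLS.maxMixed d) T)
    (hunital : QuantumLS.IsUnital T) :
    ∃ α₂ : ℝ, QuantumLS.IsLSConstant₂ (QuantumLS.maxMixed d) (T - LinearMap.id) α₂ ∧
      α₂ ≤ Real.log D * ((4 + Real.log (Real.log d)) / (2 * Real.log (3 * d / 4))) := by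
  obtain ⟨K, -, hK, hT⟩ := hreg
  have hd0 : 0 < d := by omega
  have : Nonempty (Fin d) := ⟨⟨0, hd0⟩⟩
  have hD : D ≠ 0 := by
    rintro rfl
    simp at hK
  set S : Set ℝ := {a : ℝ | ∀ f : QuantumLS.Mat d, f.PosDef →
    a * QuantumLS.ent₂ (QuantumLS.maxMixed d) f ≤
      QuantumLS.dirichlet₂ (QuantumLS.maxMixed d) (T - LinearMap.id) f} with hS
  have hbound : ∀ a ∈ S,
      a ≤ Real.log D * ((4 + Real.log (Real.log d)) / (2 * Real.log (3 * d / 4))) := by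
    intro a ha
    rcases Nat.lt_or_ge D 3 with h3 | h3
    · interval_cases D
      · exact absurd rfl hD
      · obtain ⟨ψ, hψ, h⟩ := QuantumLS.exists_unit_normSq_eq_one hd0 (U := K 0) (by simpa using hK)
        have hb := QuantumLS.bound_of_unit_vector hd0 K hT ha hψ
        rw [Fin.sum_univ_one, h, sub_self] at hb
        exact QuantumLS.le_mul_div_log_of_le hd hb le_rfl (by simp)
      -- Here `5 log 2 < 4`, so `s = 1` is too weak; the gain `1 / (2 * 2)` gives `s = 3/4`, and `3
      -- ≤ 5 log 2`.
      · obtain ⟨ψ, hψ, h⟩ := QuantumLS.exists_unit_sum_normSq_ge hd0 two_pos K hK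
        have hb := QuantumLS.bound_of_unit_vector hd0 K hT ha hψ
        refine QuantumLS.le_mul_div_log_of_le (s := 3 / 4) hd (hb.trans ?_) (by norm_num) ?_
        · norm_num at h ⊢
          linarith
        · have := Real.log_two_gt_d9
          push_cast
          linarith
    · obtain ⟨ψ, hψ, -⟩ := QuantumLS.exists_unit_sum_normSq_ge hd0 (by omega) K hK
      -- Any unit vector would do: the sum is merely dropped as nonnegative.
      have hb := QuantumLS.bound_of_unit_vector hd0 K hT ha hψ
      refine QuantumLS.le_mul_div_log_of_le (s := 1) hd
        (hb.trans (sub_le_self _ (Finset.sum_nonneg fun i _ => Complex.normSq_nonneg _)))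
        zero_le_one ?_
      have h1 : 1 ≤ Real.log D := by
        rw [Real.le_log_iff_exp_le (by positivity)]
        have h2 : (3 : ℝ) ≤ D := by exact_mod_cast h3
        linarith [Real.exp_one_lt_d9]
      linarith
  have hne : S.Nonempty := ⟨0, fun f hf => by
    rw [zero_mul]
    exact QuantumLS.dirichlet₂_nonneg hd0 K hK hT hunital hf.isHermitian⟩
  have hclosed : IsClosed S := by
    simp only [hS, Set.ofPred_forall]
    exact isClosed_iInter fun f => isClosed_iInter fun _ =>
      isClosed_le (continuous_id.mul continuous_const) continuous_const
  have hbdd : BddAbove S := ⟨_, hbound⟩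
  exact ⟨sSup S, hclosed.isGreatest_csSup hne hbdd, csSup_le hne hbound⟩
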